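/- For a separable complex Hilbert space $\mathcal H$ let $\mathfrak T(\mathcal H)$ be the space of trace-class operators on $\mathcal H$ with the trace norm $\|T\|_1=\operatorname{Tr}|T|$, and let $\mathfrak S(\mathcal H)$ be the set of states, i.e. positive operators in $\mathfrak T(\mathcal H)$ with unit trace. Let $\eta(x)=-x\ln x$ for $x>0$ and $\eta(0)=0$. The von Neumann entropy of a state $\rho$ is $H(\rho)=\operatorname{Tr}\eta(\rho)\in[0,+\infty]$; it is extended to all positive $\rho\in\mathfrak T(\mathcal H)$ by $H(\rho)=[\operatorname{Tr}\rho]\,H(\rho/\operatorname{Tr}\rho)$ for $\rho\neq0$ and $H(0)=0$. Let $\mathcal H_A,\mathcal H_B$ be separable complex Hilbert spaces and let $\Phi:\mathfrak T(\mathcal H_A)\to\mathfrak T(\mathcal H_B)$ be a linear map that is positive ($\Phi(\rho)\ge0$ for all $\rho\geq0$) and trace-non-increasing ($\operatorname{Tr}\Phi(\rho)\le\operatorname{Tr}\rho$ for all $\rho\ge0$), and whose output entropy $H_\Phi(\rho)=H(\Phi(\rho))$ is finite for every state $\rho\in\mathfrak S(\mathcal H_A)$. Put $$H_{\min}(\Phi)=\inf_{\rho\in\mathfrak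 S(\mathcal H_A)}H_\Phi(\rho),\qquad H_{\max}(\Phi)=\sup_{\rho\in\mathfrak S(\mathcal H_A)}H_\Phi(\rho).$$ Then $H_{\max}(\Phi)<+\infty$, and for any states $\rho,\sigma\in\mathfrak S(\mathcal H_A)$ $$|H_\Phi(\rho)-H_\Phi(\sigma)|\le\varepsilon\,[H_{\max}(\Phi)-H_{\min}(\Phi)]+g(\varepsilon),\qquad \varepsilon=\tfrac12\|\rho-\sigma\|_1,$$ where $g(\varepsilon)=(1+\varepsilon)\,h_2\!\left(\frac{\varepsilon}{1+\varepsilon}\right)$ and $h_2(p)=\eta(p)+\eta(1-p)$ is the binary entropy. -/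

import Mathlib

open scoped ENNReal InnerProductSpace

noncomputable section

namespace QuantumEntropy

variable {H : Type*} [NormedAddCommGroup H] [InnerProductSpace ℂ H] [CompleteSpace H]

variable (H) in
/-- A fixed orthonormal (Hilbert) basis of `H`, indexed by a set of vectors of `H`. -/
def stdBasis : HilbertBasis (exists_hilbertBasis ℂ H).choose ℂ H :=
  (exists_hilbertBasis ℂ H).choose_spec.choose

/-- The trace `Tr P = ∑ᵢ ⟨eᵢ, P eᵢ⟩ ∈ [0,∞]` of a positive bounded operator `P`.
It is used for positive operators only; its value does not depend on the orthonormal basis,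
see `trace_eq_tsum`. -/
def trace (P : H →L[ℂ] H) : ℝ≥0∞ :=
  ∑' i, ENNReal.ofReal (RCLike.re ⟪stdBasis H i, P (stdBasis H i)⟫_ℂ)

/-- The trace norm `‖T‖₁ = Tr |T|`, where `|T| = √(T* T)`. -/
def traceNorm (T : H →L[ℂ] H) : ℝ≥0∞ := trace (CFC.abs T)

/-! ### Helper facts: the trace is independent of the basis, and the operators with finite trace
norm form a linear subspace. -/

theorem enorm_sq_eq_tsum {H : Type*} [NormedAddCommGroup H] [InnerProductSpace ℂ H] {ι : Type*}
    (b : HilbertBasis ι ℂ H) (x : H) :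
    ‖x‖ₑ ^ 2 = ∑' i, ‖⟪b i, x⟫_ℂ‖ₑ ^ 2 := by
  have h := (b.hasSum_inner_mul_inner x x).mapL (Complex.reCLM)
  have h2 : HasSum (fun i => ‖⟪b i, x⟫_ℂ‖ ^ 2) (‖x‖ ^ 2) := by
    convert h using 1
    · funext i
      rw [← inner_conj_symm x (b i), RCLike.conj_mul]
      simp [← Complex.ofReal_pow]
    · exact (inner_self_eq_norm_sq (𝕜 := ℂ) x).symm
  have h3 := ENNReal.ofReal_tsum_of_nonneg (fun i => sq_nonneg ‖⟪b i, x⟫_ℂ‖) h2.summable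
  rw [h2.tsum_eq] at h3
  simpa [ENNReal.ofReal_pow, ofReal_norm] using h3

theorem tsum_enorm_sq_adjoint {ι κ : Type*} (b : HilbertBasis ι ℂ H) (c : HilbertBasis κ ℂ H)
    (A : H →L[ℂ] H) : ∑' i, ‖A (b i)‖ₑ ^ 2 = ∑' j, ‖(star A) (c j)‖ₑ ^ 2 := by
  simp_rw [enorm_sq_eq_tsum c (A _), enorm_sq_eq_tsum b ((star A) _)]
  rw [ENNReal.tsum_comm]
  refine tsum_congr fun j => tsum_congr fun i => ?_
  rw [ContinuousLinearMap.star_eq_adjoint, ContinuousLinearMap.adjoint_inner_right,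
    ← ofReal_norm, ← ofReal_norm, norm_inner_symm]

theorem ofReal_re_inner_eq {P : H →L[ℂ] H} (hP : 0 ≤ P) (x : H) :
    ENNReal.ofReal (RCLike.re ⟪x, P x⟫_ℂ) = ‖CFC.sqrt P x‖ₑ ^ 2 := by
  have hs : star (CFC.sqrt P) = CFC.sqrt P := (CFC.sqrt_nonneg P).isSelfAdjoint.star_eq
  have h1 : P x = (star (CFC.sqrt P)) (CFC.sqrt P x) := by
    rw [hs, ← mul_apply_eq_comp, CFC.sqrt_mul_sqrt_self P hP]
  rw [h1, ContinuousLinearMap.star_eq_adjoint, ContinuousLinearMap.adjoint_inner_right,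
    inner_self_eq_norm_sq, ENNReal.ofReal_pow (norm_nonneg _), ofReal_norm]

theorem trace_eq_tsum {ι : Type*} (b : HilbertBasis ι ℂ H) {P : H →L[ℂ] H} (hP : 0 ≤ P) :
    trace P = ∑' i, ENNReal.ofReal (RCLike.re ⟪b i, P (b i)⟫_ℂ) := by
  have hs : star (CFC.sqrt P) = CFC.sqrt P := (CFC.sqrt_nonneg P).isSelfAdjoint.star_eq
  simp_rw [trace, ofReal_re_inner_eq hP]
  rw [tsum_enorm_sq_adjoint (stdBasis H) b, hs]

theorem exists_contraction {A B : H →L[ℂ] H} (h : ∀ x, ‖A x‖ ≤ ‖B x‖) :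
    ∃ W : H →L[ℂ] H, (∀ x, ‖W x‖ ≤ ‖x‖) ∧ W * B = A := by
  let K : Submodule ℂ H := B.range.topologicalClosure
  have hK : ∀ x, B x ∈ K := fun x => B.range.le_topologicalClosure ⟨x, rfl⟩
  have : CompleteSpace K := B.range.isClosed_topologicalClosure.completeSpace_coe
  let e : H →ₗ[ℂ] K := (B : H →ₗ[ℂ] H).codRestrict K hK
  have hd : DenseRange e := by
    intro y
    rw [Metric.mem_closure_iff]
    intro ε hε
    obtain ⟨z, ⟨x, hx⟩, hz⟩ := Metric.mem_closure_iff.1 y.2 ε hε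
    refine ⟨e x, ⟨x, rfl⟩, ?_⟩
    subst hx
    simpa [Subtype.dist_eq, e] using hz
  have hn : ∀ x, ‖(A : H →ₗ[ℂ] H) x‖ ≤ 1 * ‖e x‖ := by
    intro x
    simpa [e] using h x
  refine ⟨((A : H →ₗ[ℂ] H).extendOfNorm e).comp K.orthogonalProjectionOnto, fun x => ?_, ?_⟩
  · calc _ ≤ 1 * ‖K.orthogonalProjectionOnto x‖ :=
        LinearMap.norm_extendOfNorm_apply_le hd 1 hn _
      _ ≤ ‖x‖ := by rw [one_mul]; exact K.norm_orthogonalProjectionOnto_apply_le x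
  · ext x
    have h1 : K.orthogonalProjectionOnto (B x) = e x :=
      K.orthogonalProjectionOnto_mem_subspace_eq_self ⟨B x, hK x⟩
    have h2 := LinearMap.extendOfNorm_eq (f := (A : H →ₗ[ℂ] H)) hd ⟨1, hn⟩ x
    simpa [h1] using h2

theorem norm_abs_apply (T : H →L[ℂ] H) (x : H) : ‖CFC.abs T x‖ = ‖T x‖ := by
  have hs : star (CFC.abs T) = CFC.abs T := (CFC.abs_nonneg T).isSelfAdjoint.star_eq
  have key : ∀ A : H →L[ℂ] H, ‖A x‖ ^ 2 = RCLike.re ⟪x, (star A * A) x⟫_ℂ := by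
    intro A
    rw [mul_apply_eq_comp, ContinuousLinearMap.star_eq_adjoint,
      ContinuousLinearMap.adjoint_inner_right, inner_self_eq_norm_sq]
  have h : ‖CFC.abs T x‖ ^ 2 = ‖T x‖ ^ 2 := by
    rw [key, key, hs, CFC.abs_mul_abs]
  exact (sq_eq_sq₀ (norm_nonneg _) (norm_nonneg _)).1 h

theorem tsum_inner_contraction_le {ι : Type*} (b : HilbertBasis ι ℂ H) (S U : H →L[ℂ] H)
    (hU : ∀ x, ‖U x‖ ≤ ‖x‖) :
    ∑' i, ENNReal.ofReal (RCLike.re ⟪b i, (U * S) (b i)⟫_ℂ) ≤ 2 * traceNorm S := by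
  obtain ⟨V, hV, hVS⟩ := exists_contraction (fun x => (norm_abs_apply S x).ge)
  set Q := CFC.sqrt (CFC.abs S) with hQ
  have hs : star Q = Q := (CFC.sqrt_nonneg _).isSelfAdjoint.star_eq
  have hQQ : Q * Q = CFC.abs S := CFC.sqrt_mul_sqrt_self _ (CFC.abs_nonneg S)
  have hT : ∑' i, ‖Q (b i)‖ₑ ^ 2 = traceNorm S := by
    rw [traceNorm, trace_eq_tsum b (CFC.abs_nonneg S)]
    simp_rw [ofReal_re_inner_eq (CFC.abs_nonneg S), ← hQ]
  set W : H →L[ℂ] H := star (U * V * Q) with hW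
  have hT2 : ∑' i, ‖W (b i)‖ₑ ^ 2 ≤ traceNorm S := by
    rw [tsum_enorm_sq_adjoint b b, hW, star_star, ← hT]
    refine ENNReal.tsum_le_tsum fun i => ?_
    gcongr
    rw [← ofReal_norm, ← ofReal_norm]
    exact ENNReal.ofReal_le_ofReal ((hU _).trans (hV _))
  have hpt : ∀ i, ENNReal.ofReal (RCLike.re ⟪b i, (U * S) (b i)⟫_ℂ) ≤
      ‖W (b i)‖ₑ ^ 2 + ‖Q (b i)‖ₑ ^ 2 := by
    intro i
    have h1 : (U * S) (b i) = (star W) (Q (b i)) := by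
      rw [hW, star_star, ← hVS, ← hQQ]
      simp
    rw [h1, ContinuousLinearMap.star_eq_adjoint, ContinuousLinearMap.adjoint_inner_right,
      ← ofReal_norm, ← ofReal_norm, ← ENNReal.ofReal_pow (norm_nonneg _),
      ← ENNReal.ofReal_pow (norm_nonneg _), ← ENNReal.ofReal_add (by positivity) (by positivity)]
    refine ENNReal.ofReal_le_ofReal ((re_inner_le_norm _ _).trans ?_)
    nlinarith [sq_nonneg (‖W (b i)‖ - ‖Q (b i)‖), sq_nonneg ‖W (b i)‖, sq_nonneg ‖Q (b i)‖]
  calc _ ≤ ∑' i, (‖W (b i)‖ₑ ^ 2 + ‖Q (b i)‖ₑ ^ 2) := ENNReal.tsum_le_tsum hpt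
    _ ≤ traceNorm S + traceNorm S := by rw [ENNReal.tsum_add, hT]; gcongr
    _ = _ := (two_mul _).symm

theorem traceNorm_add_lt_top {S T : H →L[ℂ] H} (hS : traceNorm S < ∞) (hT : traceNorm T < ∞) :
    traceNorm (S + T) < ∞ := by
  obtain ⟨U, hU, hUR⟩ := exists_contraction (fun x => (norm_abs_apply (S + T) x).le)
  have h : traceNorm (S + T) ≤ 2 * traceNorm S + 2 * traceNorm T := by
    calc _ ≤ ∑' i, (ENNReal.ofReal (RCLike.re ⟪stdBasis H i, (U * S) (stdBasis H i)⟫_ℂ) +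
          ENNReal.ofReal (RCLike.re ⟪stdBasis H i, (U * T) (stdBasis H i)⟫_ℂ)) := by
          rw [traceNorm, trace]
          refine ENNReal.tsum_le_tsum fun i => ?_
          rw [← hUR, mul_add, add_apply, inner_add_right, map_add]
          exact ENNReal.ofReal_add_le
      _ ≤ _ := by
          rw [ENNReal.tsum_add]
          exact add_le_add (tsum_inner_contraction_le _ S U hU)
            (tsum_inner_contraction_le _ T U hU)
  exact h.trans_lt (ENNReal.add_lt_top.2
    ⟨ENNReal.mul_lt_top (by simp) hS, ENNReal.mul_lt_top (by simp) hT⟩)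

theorem traceNorm_zero : traceNorm (0 : H →L[ℂ] H) = 0 := by
  simp [traceNorm, trace]

theorem traceNorm_smul_lt_top (c : ℂ) {T : H →L[ℂ] H} (hT : traceNorm T < ∞) :
    traceNorm (c • T) < ∞ := by
  have h : traceNorm (c • T) = ENNReal.ofReal ‖c‖ * traceNorm T := by
    rw [traceNorm, traceNorm, CFC.abs_smul, trace, trace, ← ENNReal.tsum_mul_left]
    refine tsum_congr fun i => ?_
    rw [← ENNReal.ofReal_mul (norm_nonneg c), smul_apply,
      ← Complex.coe_smul, inner_smul_right]
    congr 1
    exact Complex.re_ofReal_mul _ _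
  rw [h]
  exact ENNReal.mul_lt_top ENNReal.ofReal_lt_top hT

/-! ### The objects of the theorem -/

variable (H) in
/-- `𝔗(H)`: the space of trace-class operators, i.e. bounded operators `T` with `Tr |T| < ∞`. -/
def TraceClass : Submodule ℂ (H →L[ℂ] H) where
  carrier := {T | traceNorm T < ∞}
  add_mem' := traceNorm_add_lt_top
  zero_mem' := by simp [traceNorm_zero]
  smul_mem' := fun c _ hT => traceNorm_smul_lt_top c hT

variable (H) in
/-- `𝔖(H)`: the set of states, i.e. positive trace-class operators with unit trace. -/
def states : Set (TraceClass H) :=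
  {ρ | (ρ : H →L[ℂ] H).IsPositive ∧ trace (ρ : H →L[ℂ] H) = 1}

/-- The von Neumann entropy `Tr η(ρ) ∈ [0,∞]` of a state `ρ`, with `η(x) = -x ln x`, `η(0) = 0`,
and `η(ρ)` given by the continuous functional calculus. -/
def stateEntropy (ρ : H →L[ℂ] H) : ℝ≥0∞ := trace (cfc Real.negMulLog ρ)

/-- The homogeneous extension `H(ρ) = [Tr ρ] H(ρ / Tr ρ) ∈ [0,∞]` of the von Neumann entropy to
the cone of positive trace-class operators; it is `0` at `ρ = 0`. -/
def entropy (ρ : TraceClass H) : ℝ≥0∞ :=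
  trace (ρ : H →L[ℂ] H) *
    stateEntropy (((trace (ρ : H →L[ℂ] H)).toReal : ℂ)⁻¹ • (ρ : H →L[ℂ] H))

variable {A B : Type*} [NormedAddCommGroup A] [InnerProductSpace ℂ A] [CompleteSpace A]
  [NormedAddCommGroup B] [InnerProductSpace ℂ B] [CompleteSpace B]

/-- A linear map `Φ : 𝔗(A) → 𝔗(B)` is positive if it maps positive operators to positive ones. -/
def IsPositiveMap (Φ : TraceClass A →ₗ[ℂ] TraceClass B) : Prop :=
  ∀ ρ : TraceClass A, (ρ : A →L[ℂ] A).IsPositive → (Φ ρ : B →L[ℂ] B).IsPositive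

/-- `Φ` is trace-non-increasing: `Tr Φ(ρ) ≤ Tr ρ` for all positive trace-class `ρ`. -/
def IsTraceNonincreasing (Φ : TraceClass A →ₗ[ℂ] TraceClass B) : Prop :=
  ∀ ρ : TraceClass A, (ρ : A →L[ℂ] A).IsPositive →
    trace (Φ ρ : B →L[ℂ] B) ≤ trace (ρ : A →L[ℂ] A)

/-- The output entropy `H_Φ(ρ) = H(Φ(ρ))`. -/
def outputEntropy (Φ : TraceClass A →ₗ[ℂ] TraceClass B) (ρ : TraceClass A) : ℝ≥0∞ :=
  entropy (Φ ρ)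

/-- `H_max(Φ)`, the supremum of the output entropy over all input states. -/
def maxOutputEntropy (Φ : TraceClass A →ₗ[ℂ] TraceClass B) : ℝ≥0∞ :=
  ⨆ ρ ∈ states A, outputEntropy Φ ρ

/-- `H_min(Φ)`, the infimum of the output entropy over all input states. -/
def minOutputEntropy (Φ : TraceClass A →ₗ[ℂ] TraceClass B) : ℝ≥0∞ :=
  ⨅ ρ ∈ states A, outputEntropy Φ ρ

/-- `½‖ρ - σ‖₁`; this is a real number since `ρ - σ` is trace-class. -/
def traceDist (ρ σ : TraceClass H) : ℝ :=
  (1 / 2) * (traceNorm ((ρ - σ : TraceClass H) : H →L[ℂ] H)).toReal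

/-- `g(ε) = (1 + ε) h₂(ε / (1 + ε))`, with `h₂` the binary entropy (natural logarithm). -/
def gFun (ε : ℝ) : ℝ := (1 + ε) * Real.binEntropy (ε / (1 + ε))

end QuantumEntropy

end

open scoped ENNReal InnerProductSpace

noncomputable section

namespace QuantumEntropy

universe u

variable {H : Type u} [NormedAddCommGroup H] [InnerProductSpace ℂ H] [CompleteSpace H]

/-! ### The trace on positive operators -/

/-! Let `S` and `T` be the positive and negative parts of `ρ - σ`. Both have trace `ε`, and `ρ + T =
σ + S`. Apply `Φ` and estimate the entropy of this common operator in two ways. Superadditivity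
(`entropy_add_entropy_le`) bounds it below by `H(Φρ) + H(ΦT)`. Almost-subadditivity
(`entropy_add_le`) bounds it above by `H(Φσ) + H(ΦS)` plus a mixing term. By homogeneity `H(ΦT) ≥ ε
H_min` and `H(ΦS) ≤ ε H_max`, and with weights `1/(1+ε)`, `ε/(1+ε)` the mixing term is at most
`g(ε)`. Exchanging `ρ` and `σ` gives the absolute value.

Superadditivity is concavity of `Tr η`, proved by testing in an eigenbasis of the mixture.
Almost-subadditivity is `Tr η(P + Q) ≤ Tr η(P) + Tr η(Q)`, which rests on operator monotonicity of
the logarithm.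

Superadditivity also makes the output entropy monotone on the positive cone. If `H_max` were
infinite, a countable mixture of states of rapidly growing output entropy would be a state of
infinite output entropy. Only positivity and linearity of `Φ` enter here, not continuity. -/

theorem re_inner_mono {P Q : H →L[ℂ] H} (h : P ≤ Q) (x : H) :
    RCLike.re ⟪x, P x⟫_ℂ ≤ RCLike.re ⟪x, Q x⟫_ℂ := by
  have h1 := (ContinuousLinearMap.nonneg_iff_isPositive _).1 (sub_nonneg.2 h)
  have h2 := h1.re_inner_nonneg_right x
  rw [sub_apply, inner_sub_right, map_sub] at h2
  linarith

theorem re_inner_nonneg {P : H →L[ℂ] H} (h : 0 ≤ P) (x : H) :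
    0 ≤ RCLike.re ⟪x, P x⟫_ℂ := by
  simpa using re_inner_mono h x

theorem trace_mono {P Q : H →L[ℂ] H} (h : P ≤ Q) : trace P ≤ trace Q :=
  ENNReal.tsum_le_tsum fun _ => ENNReal.ofReal_le_ofReal (re_inner_mono h _)

theorem trace_add {P Q : H →L[ℂ] H} (hP : 0 ≤ P) (hQ : 0 ≤ Q) :
    trace (P + Q) = trace P + trace Q := by
  rw [trace, trace, trace, ← ENNReal.tsum_add]
  refine tsum_congr fun i => ?_
  rw [add_apply, inner_add_right, map_add,
    ENNReal.ofReal_add (re_inner_nonneg hP _) (re_inner_nonneg hQ _)]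

theorem trace_smul {c : ℝ} (hc : 0 ≤ c) (P : H →L[ℂ] H) :
    trace (c • P) = ENNReal.ofReal c * trace P := by
  rw [trace, trace, ← ENNReal.tsum_mul_left]
  refine tsum_congr fun i => ?_
  rw [← ENNReal.ofReal_mul hc, smul_apply, ← Complex.coe_smul, inner_smul_right]
  congr 1
  exact Complex.re_ofReal_mul _ _

theorem trace_star_mul_self (A : H →L[ℂ] H) :
    trace (star A * A) = ∑' i, ‖A (stdBasis H i)‖ₑ ^ 2 := by
  refine tsum_congr fun i => ?_
  rw [mul_apply_eq_comp, ContinuousLinearMap.star_eq_adjoint,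
    ContinuousLinearMap.adjoint_inner_right, inner_self_eq_norm_sq,
    ENNReal.ofReal_pow (norm_nonneg _), ofReal_norm]

theorem trace_star_mul_self_comm (A : H →L[ℂ] H) :
    trace (star A * A) = trace (A * star A) := by
  have h := trace_star_mul_self (star A)
  rw [star_star] at h
  rw [trace_star_mul_self, h, tsum_enorm_sq_adjoint (stdBasis H) (stdBasis H)]

/-- Cyclicity, `Tr A*A = Tr AA*` with `A = √P √L`. Both sides stand for `Tr PL`, written with
positive operators so that they make sense in `[0,∞]`. -/
theorem trace_conj_sqrt_comm {P L : H →L[ℂ] H} (hP : 0 ≤ P) (hL : 0 ≤ L) :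
    trace (CFC.sqrt L * P * CFC.sqrt L) = trace (CFC.sqrt P * L * CFC.sqrt P) := by
  have h1 : star (CFC.sqrt P) = CFC.sqrt P := (CFC.sqrt_nonneg P).isSelfAdjoint.star_eq
  have h2 : star (CFC.sqrt L) = CFC.sqrt L := (CFC.sqrt_nonneg L).isSelfAdjoint.star_eq
  have h := trace_star_mul_self_comm (CFC.sqrt P * CFC.sqrt L)
  rw [star_mul, h1, h2] at h
  rw [show CFC.sqrt L * P * CFC.sqrt L
      = CFC.sqrt L * CFC.sqrt P * (CFC.sqrt P * CFC.sqrt L) by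
        conv_lhs => rw [← CFC.sqrt_mul_sqrt_self P hP]
        simp only [mul_assoc], h]
  conv_rhs => rw [← CFC.sqrt_mul_sqrt_self L hL]
  simp only [mul_assoc]

theorem enorm_sq_apply_le {ι : Type*} (b : HilbertBasis ι ℂ H) (A : H →L[ℂ] H) (x : H) :
    ‖A x‖ₑ ^ 2 ≤ (∑' i, ‖A (b i)‖ₑ ^ 2) * ‖x‖ₑ ^ 2 := by
  rw [tsum_enorm_sq_adjoint b b, enorm_sq_eq_tsum b (A x), ← ENNReal.tsum_mul_right]
  refine ENNReal.tsum_le_tsum fun i => ?_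
  rw [← mul_pow]
  gcongr
  rw [← ContinuousLinearMap.adjoint_inner_left, ← ContinuousLinearMap.star_eq_adjoint,
    ← ofReal_norm, ← ofReal_norm, ← ofReal_norm, ← ENNReal.ofReal_mul (norm_nonneg _)]
  exact ENNReal.ofReal_le_ofReal (norm_inner_le_norm _ _)

theorem ofReal_re_inner_le_trace {P : H →L[ℂ] H} (hP : 0 ≤ P) (x : H) :
    ENNReal.ofReal (RCLike.re ⟪x, P x⟫_ℂ) ≤ trace P * ‖x‖ₑ ^ 2 := by
  rw [ofReal_re_inner_eq hP, trace]
  simp_rw [ofReal_re_inner_eq hP]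
  exact enorm_sq_apply_le _ _ _

theorem eq_zero_of_trace_eq_zero {P : H →L[ℂ] H} (hP : 0 ≤ P) (h : trace P = 0) : P = 0 := by
  have h1 : CFC.sqrt P = 0 := by
    ext x
    have := ofReal_re_inner_le_trace hP x
    rw [h, ofReal_re_inner_eq hP] at this
    simpa using this
  rw [← CFC.sqrt_mul_sqrt_self P hP, h1, zero_mul]

theorem le_of_re_inner_le {P Q : H →L[ℂ] H} (hP : IsSelfAdjoint P) (hQ : IsSelfAdjoint Q)
    (h : ∀ x, RCLike.re ⟪x, P x⟫_ℂ ≤ RCLike.re ⟪x, Q x⟫_ℂ) : P ≤ Q := by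
  rw [ContinuousLinearMap.le_def, ContinuousLinearMap.isPositive_def']
  refine ⟨hQ.sub hP, fun x => ?_⟩
  rw [ContinuousLinearMap.reApplyInnerSelf, inner_re_symm, sub_apply, inner_sub_right, map_sub]
  exact sub_nonneg.2 (h x)

theorem le_one_of_trace_le_one {P : H →L[ℂ] H} (hP : 0 ≤ P) (h : trace P ≤ 1) : P ≤ 1 := by
  refine le_of_re_inner_le hP.isSelfAdjoint (IsSelfAdjoint.one _) fun x => ?_
  have h1 := (ofReal_re_inner_le_trace hP x).trans (mul_le_of_le_one_left' h)
  rwa [← ofReal_norm, ← ENNReal.ofReal_pow (norm_nonneg _),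
    ENNReal.ofReal_le_ofReal_iff (by positivity), ← inner_self_eq_norm_sq (𝕜 := ℂ) x] at h1

/-! ### Subadditivity of `Tr η` -/

theorem spectrum_subset_Icc {P : H →L[ℂ] H} (hP : 0 ≤ P) (hP1 : P ≤ 1) {x : ℝ}
    (hx : x ∈ spectrum ℝ P) : 0 ≤ x ∧ x ≤ 1 := by
  refine ⟨spectrum_nonneg_of_nonneg hP hx, ?_⟩
  have := (le_algebraMap_iff_spectrum_le (R := ℝ) (r := 1) (a := P)).1 (by simpa using hP1)
  exact this x hx

/-- The function `x ↦ -log ((x + δ) / (1 + δ))`, a bounded approximation of `-log`. -/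
def negLogShift (δ x : ℝ) : ℝ := -Real.log ((x + δ) / (1 + δ))

theorem continuousOn_negLogShift {δ : ℝ} (hδ : 0 < δ) :
    ContinuousOn (negLogShift δ) (Set.Ici 0) := by
  refine (ContinuousOn.log (by fun_prop) fun x hx => ?_).neg
  have : (0 : ℝ) ≤ x := hx
  positivity

theorem negLogShift_nonneg {δ x : ℝ} (hδ : 0 < δ) (hx : 0 ≤ x) (hx1 : x ≤ 1) :
    0 ≤ negLogShift δ x := by
  rw [negLogShift, neg_nonneg]
  refine Real.log_nonpos (by positivity) ?_
  rw [div_le_one (by positivity)]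
  linarith

theorem mul_negLogShift_le {δ x : ℝ} (hδ : 0 < δ) (hx : 0 ≤ x) (hx1 : x ≤ 1) :
    x * negLogShift δ x ≤ Real.negMulLog x := by
  rcases hx.eq_or_lt with rfl | hx0
  · simp
  rw [negLogShift, Real.negMulLog, mul_neg, neg_mul, neg_le_neg_iff]
  refine mul_le_mul_of_nonneg_left (Real.log_le_log hx0 ?_) hx
  rw [le_div_iff₀ (by positivity)]
  nlinarith

/-- With `mul_negLogShift_le`, this places `x * negLogShift δ x` within `δ` of `η(x)` uniformly on
`[0,1]`; it follows from `log y ≤ y - 1`. -/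
theorem negMulLog_le_add {δ x : ℝ} (hδ : 0 < δ) (hx : 0 ≤ x) :
    Real.negMulLog x ≤ x * negLogShift δ x + δ := by
  rcases hx.eq_or_lt with rfl | hx0
  · simpa using hδ.le
  have h1 : Real.log ((x + δ) / (1 + δ)) - Real.log x ≤ δ / x := by
    rw [← Real.log_div (by positivity) (by positivity)]
    refine (Real.log_le_sub_one_of_pos (by positivity)).trans ?_
    rw [div_div, sub_le_iff_le_add, div_add_one hx0.ne', div_le_div_iff₀ (by positivity) hx0]
    nlinarith [mul_pos hx0 hδ, mul_pos (mul_pos hx0 hδ) hδ, mul_pos (mul_pos hx0 hx0) hδ]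
  rw [negLogShift, Real.negMulLog]
  have h2 := mul_le_mul_of_nonneg_left h1 hx
  rw [mul_div_cancel₀ _ hx0.ne'] at h2
  linarith

/-- Operator monotonicity of `log`. The shift by `δ` makes the arguments invertible even when `P` is
not. -/
theorem cfc_negLogShift_antitone {δ : ℝ} (hδ : 0 < δ) {P Q : H →L[ℂ] H} (hP : 0 ≤ P)
    (h : P ≤ Q) : cfc (negLogShift δ) Q ≤ cfc (negLogShift δ) P := by
  have key : ∀ R : H →L[ℂ] H, 0 ≤ R → cfc (negLogShift δ) R
      = -CFC.log ((1 + δ)⁻¹ • (R + algebraMap ℝ _ δ)) := by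
    intro R hR
    have e1 : (1 + δ)⁻¹ • (R + algebraMap ℝ _ δ) = cfc (fun x : ℝ => (1 + δ)⁻¹ * (x + δ)) R := by
      rw [cfc_const_mul _ (fun x : ℝ => x + δ) R, cfc_add_const δ (fun x : ℝ => x) R, cfc_id' ℝ R]
    have hc : ContinuousOn Real.log ((fun x : ℝ => (1 + δ)⁻¹ * (x + δ)) '' spectrum ℝ R) := by
      refine ContinuousOn.log (by fun_prop) ?_
      rintro y ⟨x, hx, rfl⟩
      have : 0 ≤ x := spectrum_nonneg_of_nonneg hR hx
      positivity
    rw [e1, CFC.log, ← cfc_comp' Real.log (fun x : ℝ => (1 + δ)⁻¹ * (x + δ)) R hc, ← cfc_neg]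
    · refine cfc_congr fun x _ => ?_
      simp only [negLogShift]
      rw [div_eq_inv_mul]
  have hQ := hP.trans h
  rw [key Q hQ, key P hP, neg_le_neg_iff]
  refine CFC.log_le_log ?_ ?_
  · exact smul_le_smul_of_nonneg_left (add_le_add_left h _) (by positivity)
  -- The shifted operator dominates the positive scalar `δ / (1 + δ)`.
  · have h0 : IsStrictlyPositive (algebraMap ℝ (H →L[ℂ] H) ((1 + δ)⁻¹ * δ)) := by
      refine ⟨?_, (IsUnit.mk0 _ (by positivity)).map _⟩
      rw [Algebra.algebraMap_eq_smul_one]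
      exact smul_nonneg (by positivity) zero_le_one
    refine h0.of_le ?_
    rw [smul_add, map_mul, ← Algebra.smul_def]
    exact le_add_of_nonneg_left (smul_nonneg (by positivity) hP)

theorem conj_sqrt_mono {P L M : H →L[ℂ] H} (h : L ≤ M) :
    CFC.sqrt P * L * CFC.sqrt P ≤ CFC.sqrt P * M * CFC.sqrt P := by
  have h2 := star_left_conjugate_le_conjugate h (CFC.sqrt P)
  rwa [(CFC.sqrt_nonneg P).isSelfAdjoint.star_eq] at h2

theorem conj_sqrt_cfc {f : ℝ → ℝ} {P : H →L[ℂ] H} (hP : 0 ≤ P)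
    (hf : ContinuousOn f (spectrum ℝ P)) :
    CFC.sqrt P * cfc f P * CFC.sqrt P = cfc (fun x => x * f x) P := by
  have hc : Commute (CFC.sqrt P) (cfc f P) := by
    rw [CFC.sqrt_eq_real_sqrt P hP, cfcₙ_eq_cfc]
    exact cfc_commute_cfc _ _ _
  rw [hc.eq, mul_assoc, CFC.sqrt_mul_sqrt_self P hP]
  simp_rw [mul_comm _ (f _)]
  rw [cfc_mul f (fun x : ℝ => x) P, cfc_id' ℝ P]

/-- The limit `δ → 0`. The error `δ` times the identity may have infinite trace, so `δ` is chosen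
only after restricting to a finite partial sum. -/
theorem trace_cfc_negMulLog_le_of_forall {P : H →L[ℂ] H} (hP : 0 ≤ P) (hP1 : P ≤ 1) {C : ℝ≥0∞}
    (h : ∀ δ : ℝ, 0 < δ → trace (cfc (fun x => x * negLogShift δ x) P) ≤ C) :
    trace (cfc Real.negMulLog P) ≤ C := by
  have hm : ∀ δ : ℝ, 0 < δ → ContinuousOn (fun x => x * negLogShift δ x) (spectrum ℝ P) :=
    fun δ hδ => continuousOn_id.mul <|
      (continuousOn_negLogShift hδ).mono fun x hx => spectrum_nonneg_of_nonneg hP hx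
  rw [trace, ENNReal.tsum_eq_iSup_sum]
  refine iSup_le fun s => ?_
  refine ENNReal.le_of_forall_pos_le_add fun ε hε _ => ?_
  -- The error is paid once per index of `s`, for a total of at most `ε`; the `+ 1` covers empty
  -- `s`.
  set δ : ℝ := ε / (s.card + 1) with hδ
  have hδ0 : 0 < δ := by positivity
  have hle : cfc Real.negMulLog P ≤ cfc (fun x => x * negLogShift δ x) P + algebraMap ℝ _ δ := by
    rw [← cfc_add_const δ _ P (hm δ hδ0)]
    refine cfc_mono (fun x hx => negMulLog_le_add hδ0 (spectrum_nonneg_of_nonneg hP hx))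
      Real.continuous_negMulLog.continuousOn ((hm δ hδ0).add continuousOn_const)
  have hnn : 0 ≤ cfc (fun x => x * negLogShift δ x) P := cfc_nonneg fun x hx => by
    have := spectrum_subset_Icc hP hP1 hx
    exact mul_nonneg this.1 (negLogShift_nonneg hδ0 this.1 this.2)
  calc _ ≤ ∑ i ∈ s, (ENNReal.ofReal (RCLike.re ⟪stdBasis H i,
          cfc (fun x => x * negLogShift δ x) P (stdBasis H i)⟫_ℂ) + ENNReal.ofReal δ) := by
        refine Finset.sum_le_sum fun i _ => ?_
        rw [← ENNReal.ofReal_add (re_inner_nonneg hnn _) hδ0.le]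
        refine ENNReal.ofReal_le_ofReal ((re_inner_mono hle _).trans_eq ?_)
        rw [add_apply, inner_add_right, map_add, Algebra.algebraMap_eq_smul_one, smul_apply,
          one_apply_eq_self, ← Complex.coe_smul, inner_smul_right,
          inner_self_eq_norm_sq_to_K, (stdBasis H).orthonormal.norm_eq_one]
        simp
    _ ≤ trace (cfc (fun x => x * negLogShift δ x) P) + ε := by
        rw [Finset.sum_add_distrib]
        refine add_le_add (ENNReal.sum_le_tsum s) ?_
        rw [Finset.sum_const, nsmul_eq_mul, ← ENNReal.ofReal_natCast,
          ← ENNReal.ofReal_mul (by positivity), ← ENNReal.ofReal_coe_nnreal]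
        refine ENNReal.ofReal_le_ofReal ?_
        rw [hδ, mul_div_assoc', div_le_iff₀ (by positivity)]
        nlinarith [ε.2]
    _ ≤ C + ε := by gcongr; exact h δ hδ0

/-- Formally `-Tr (P + Q) log (P + Q)` splits into two terms, and `-log (P + Q) ≤ -log P` bounds the
first by `Tr η(P)`, likewise for `Q`. The bounded function `negLogShift δ` replaces `-log` to make
this rigorous. -/
theorem trace_cfc_negMulLog_add_le {P Q : H →L[ℂ] H} (hP : 0 ≤ P) (hQ : 0 ≤ Q)
    (h1 : P + Q ≤ 1) :
    trace (cfc Real.negMulLog (P + Q)) ≤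
      trace (cfc Real.negMulLog P) + trace (cfc Real.negMulLog Q) := by
  have hPQ : 0 ≤ P + Q := add_nonneg hP hQ
  have hc : ∀ δ : ℝ, 0 < δ → ∀ R : H →L[ℂ] H, 0 ≤ R →
      ContinuousOn (negLogShift δ) (spectrum ℝ R) := fun δ hδ R hR =>
    (continuousOn_negLogShift hδ).mono fun x hx => spectrum_nonneg_of_nonneg hR hx
  refine trace_cfc_negMulLog_le_of_forall hPQ h1 fun δ hδ => ?_
  set L := cfc (negLogShift δ) (P + Q) with hL
  have hL0 : 0 ≤ L := cfc_nonneg fun x hx =>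
    negLogShift_nonneg hδ (spectrum_subset_Icc hPQ h1 hx).1 (spectrum_subset_Icc hPQ h1 hx).2
  have part : ∀ R : H →L[ℂ] H, 0 ≤ R → R ≤ P + Q →
      trace (CFC.sqrt L * R * CFC.sqrt L) ≤ trace (cfc Real.negMulLog R) := by
    intro R hR hle
    rw [trace_conj_sqrt_comm hR hL0]
    refine trace_mono ((conj_sqrt_mono (cfc_negLogShift_antitone hδ hR hle)).trans ?_)
    rw [conj_sqrt_cfc hR (hc δ hδ R hR)]
    refine cfc_mono (fun x hx => ?_) (continuousOn_id.mul (hc δ hδ R hR))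
      Real.continuous_negMulLog.continuousOn
    have := spectrum_subset_Icc hR (hle.trans h1) hx
    exact mul_negLogShift_le hδ this.1 this.2
  rw [← conj_sqrt_cfc hPQ (hc δ hδ _ hPQ), ← hL, ← trace_conj_sqrt_comm hPQ hL0, mul_add, add_mul,
    trace_add]
  · exact add_le_add (part P hP (le_add_of_nonneg_right hQ)) (part Q hQ (le_add_of_nonneg_left hP))
  · simpa using conj_sqrt_mono (P := L) hP
  · simpa using conj_sqrt_mono (P := L) hQ

/-! ### Diagonalization of positive trace-class operators -/

theorem opENorm_sq_le {ι : Type*} (b : HilbertBasis ι ℂ H) (A : H →L[ℂ] H) :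
    ‖A‖ₑ ^ 2 ≤ ∑' i, ‖A (b i)‖ₑ ^ 2 := by
  by_cases h : ∑' i, ‖A (b i)‖ₑ ^ 2 = ∞
  · simp [h]
  have hA : ‖A‖ ≤ √(∑' i, ‖A (b i)‖ₑ ^ 2).toReal := by
    refine A.opNorm_le_bound (Real.sqrt_nonneg _) fun x => ?_
    have h1 := ENNReal.toReal_mono (ENNReal.mul_ne_top h (by simp)) (enorm_sq_apply_le b A x)
    rw [ENNReal.toReal_mul, ENNReal.toReal_pow, ENNReal.toReal_pow, toReal_enorm,
      toReal_enorm] at h1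
    rw [← Real.sqrt_sq (norm_nonneg x), ← Real.sqrt_mul ENNReal.toReal_nonneg]
    exact Real.le_sqrt_of_sq_le h1
  rw [← ofReal_norm, ← ENNReal.ofReal_pow (norm_nonneg _)]
  refine ENNReal.ofReal_le_of_le_toReal ?_
  exact (Real.le_sqrt (norm_nonneg _) ENNReal.toReal_nonneg).1 hA

/-- A Hilbert–Schmidt operator is the norm limit of its finite-rank truncations, the squared error
being bounded by a tail of the convergent sum. -/
theorem isCompactOperator_of_tsum_enorm_sq_ne_top {ι : Type*} (b : HilbertBasis ι ℂ H)
    {A : H →L[ℂ] H} (hA : ∑' i, ‖A (b i)‖ₑ ^ 2 ≠ ∞) : IsCompactOperator A := by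
  classical
  set F : Finset ι → (H →L[ℂ] H) := fun s => ∑ i ∈ s, (innerSL ℂ (b i)).smulRight (A (b i)) with hF
  have hFb : ∀ s i, F s (b i) = if i ∈ s then A (b i) else 0 := by
    intro s i
    simp only [hF, sum_apply, ContinuousLinearMap.smulRight_apply, innerSL_apply_apply,
      orthonormal_iff_ite.1 b.orthonormal, ite_smul, one_smul, zero_smul, Finset.sum_ite_eq']
  have hle : ∀ s, ‖A - F s‖ₑ ^ 2 ≤ ∑' i : {i // i ∉ s}, ‖A (b i)‖ₑ ^ 2 := by
    intro s
    have h1 : ∑' i, ‖(A - F s) (b i)‖ₑ ^ 2 = ∑' i : {i // i ∉ s}, ‖A (b i)‖ₑ ^ 2 := by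
      rw [← tsum_subtype_eq_of_support_subset (s := {i | i ∉ s})]
      · refine tsum_congr fun i => ?_
        have := i.2
        simp only [Set.mem_ofPred_eq] at this
        rw [sub_apply, hFb, if_neg this, sub_zero]
      · intro i hi his
        simp [hFb, his] at hi
    rw [← h1]
    exact opENorm_sq_le b _
  have ht : Filter.Tendsto F Filter.atTop (nhds A) := by
    rw [tendsto_iff_edist_tendsto_0]
    have h0 := ENNReal.tendsto_tsum_compl_atTop_zero hA
    have h1 : Filter.Tendsto (fun s => ‖A - F s‖ₑ ^ 2) Filter.atTop (nhds 0) :=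
      tendsto_of_tendsto_of_tendsto_of_le_of_le tendsto_const_nhds h0 (fun _ => bot_le) hle
    have h2 := (ENNReal.continuous_rpow_const (y := 1 / 2)).tendsto 0 |>.comp h1
    refine (h2.congr fun s => ?_).trans_eq ?_
    · rw [Function.comp_apply, ← ENNReal.rpow_natCast, ← ENNReal.rpow_mul, edist_comm,
        edist_eq_enorm_sub]
      norm_num
    · simp
  refine isCompactOperator_of_tendsto ht (Filter.Eventually.of_forall fun s => ?_)
  refine Submodule.sum_mem (compactOperator (RingHom.id ℂ) H H) fun i _ => ?_
  exact (isCompactOperator_of_locallyCompactSpace_rng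
    (ContinuousLinearMap.toSpanSingleton ℂ (A (b i)))).comp_clm (innerSL ℂ (b i))

theorem isCompactOperator_of_trace_ne_top {P : H →L[ℂ] H} (hP : 0 ≤ P) (h : trace P ≠ ∞) :
    IsCompactOperator P := by
  have h1 : IsCompactOperator (CFC.sqrt P : H →L[ℂ] H) := by
    refine isCompactOperator_of_tsum_enorm_sq_ne_top (stdBasis H) ?_
    simpa only [trace, ofReal_re_inner_eq hP] using h
  have h2 : IsCompactOperator (CFC.sqrt P * CFC.sqrt P : H →L[ℂ] H) := h1.comp_clm (CFC.sqrt P)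
  rwa [CFC.sqrt_mul_sqrt_self P hP] at h2

/-- Orthonormal bases of all eigenspaces, the kernel included, are glued together; the spectral
theorem for compact self-adjoint operators leaves no orthogonal complement. -/
theorem exists_eigenbasis {P : H →L[ℂ] H} (hP : 0 ≤ P) (h : trace P ≠ ∞) :
    ∃ (ι : Type u) (b : HilbertBasis ι ℂ H) (μ : ι → ℝ), ∀ i, P (b i) = μ i • b i := by
  have hsym : (P : H →ₗ[ℂ] H).IsSymmetric := hP.isSelfAdjoint.isSymmetric
  let V : ℂ → Submodule ℂ H := fun μ => Module.End.eigenspace (P : H →ₗ[ℂ] H) μ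
  have hV : ∀ μ (x : H), x ∈ V μ ↔ P x = μ • x := fun μ x => Module.End.mem_eigenspace_iff
  have hVc : ∀ μ, CompleteSpace (V μ) := by
    intro μ
    have : IsClosed (V μ : Set H) := by
      have : (V μ : Set H) = {x | P x = μ • x} := Set.ext fun x => hV μ x
      rw [this]
      exact isClosed_eq P.continuous (continuous_const_smul μ)
    exact this.completeSpace_coe
  have hb : ∀ μ, ∃ w : Set (V μ), Nonempty (HilbertBasis w ℂ (V μ)) := fun μ => by
    obtain ⟨w, b, _⟩ := exists_hilbertBasis ℂ (V μ)
    exact ⟨w, ⟨b⟩⟩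
  choose w c using hb
  have horth := hsym.orthogonalFamily_eigenspaces.orthonormal_sigma_orthonormal
    (fun μ => (c μ).some.orthonormal)
  have hbot : (Submodule.span ℂ (Set.range fun a : Σ μ, w μ =>
      (V a.1).subtypeₗᵢ ((c a.1).some a.2)))ᗮ = ⊥ := by
    rw [eq_bot_iff, ← ContinuousLinearMap.orthogonalComplement_iSup_eigenspaces_eq_bot
      (isCompactOperator_of_trace_ne_top hP h) hsym]
    intro x hx
    rw [← Submodule.iInf_orthogonal, Submodule.mem_iInf]
    intro μ
    have h0 : (V μ).orthogonalProjectionOnto x = 0 := by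
      have h2 := enorm_sq_eq_tsum (c μ).some ((V μ).orthogonalProjectionOnto x)
      have h3 : ∀ i, ⟪(c μ).some i, (V μ).orthogonalProjectionOnto x⟫_ℂ = 0 := by
        intro i
        rw [Submodule.inner_orthogonalProjectionOnto_eq_of_mem_left]
        exact (Submodule.mem_orthogonal _ _).1 hx _ (Submodule.subset_span ⟨⟨μ, i⟩, rfl⟩)
      simp_rw [h3] at h2
      simpa using h2
    exact Submodule.orthogonalProjectionOnto_eq_zero_iff.1 h0
  refine ⟨_, HilbertBasis.mkOfOrthogonalEqBot horth hbot, fun a => RCLike.re a.1, fun a => ?_⟩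
  simp only [HilbertBasis.coe_mkOfOrthogonalEqBot]
  change P ((c a.1).some a.2 : V a.1) = RCLike.re a.1 • (((c a.1).some a.2 : V a.1) : H)
  have h1 := ((c a.1).some a.2).2
  have h2 := (hV _ _).1 h1
  have h3 : (starRingEnd ℂ) a.1 = a.1 := by
    refine hsym.conj_eigenvalue_eq_self (Module.End.hasEigenvalue_of_hasEigenvector ⟨h1, ?_⟩)
    intro h0
    have := (c a.1).some.orthonormal.norm_eq_one a.2
    rw [show (c a.1).some a.2 = 0 from Subtype.ext h0, norm_zero] at this
    exact zero_ne_one this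
  rw [← Complex.coe_smul]
  exact h2.trans (congrArg (· • (((c a.1).some a.2 : V a.1) : H)) (Complex.conj_eq_iff_re.1 h3).symm)

/-! ### Concavity of `Tr η` -/

theorem negMulLog_le_tangent {t x : ℝ} (ht : 0 < t) (hx : 0 ≤ x) :
    Real.negMulLog x ≤ (-Real.log t - 1) * x + t := by
  rcases hx.eq_or_lt with rfl | hx0
  · simpa using ht.le
  have h1 := Real.log_le_sub_one_of_pos (x := t / x) (by positivity)
  rw [Real.log_div ht.ne' hx0.ne'] at h1
  have h2 := mul_le_mul_of_nonneg_left h1 hx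
  rw [mul_sub, mul_sub, mul_div_cancel₀ _ hx0.ne'] at h2
  rw [Real.negMulLog]
  linarith

/-- The parabola touches `η` at `x = t`. Being a quadratic polynomial, it can be evaluated on an
eigenvector directly. -/
theorem parabola_le_negMulLog {t x : ℝ} (ht : 0 < t) (hx : 0 ≤ x) :
    (1 - Real.log t) * x + -t⁻¹ * x ^ 2 ≤ Real.negMulLog x := by
  rcases hx.eq_or_lt with rfl | hx0
  · simp
  have h1 := Real.log_le_sub_one_of_pos (x := x / t) (by positivity)
  rw [Real.log_div hx0.ne' ht.ne'] at h1
  have h2 := mul_le_mul_of_nonneg_left h1 hx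
  rw [Real.negMulLog]
  have h3 : x * (x / t - 1) = t⁻¹ * x ^ 2 - x := by ring
  linarith

omit [CompleteSpace H] in
theorem re_inner_smul_apply (c : ℝ) (P : H →L[ℂ] H) (x : H) :
    RCLike.re ⟪x, (c • P) x⟫_ℂ = c * RCLike.re ⟪x, P x⟫_ℂ := by
  rw [smul_apply, ← Complex.coe_smul, inner_smul_right]
  exact Complex.re_ofReal_mul _ _

omit [CompleteSpace H] in
theorem re_inner_add_apply (P Q : H →L[ℂ] H) (x : H) :
    RCLike.re ⟪x, (P + Q) x⟫_ℂ = RCLike.re ⟪x, P x⟫_ℂ + RCLike.re ⟪x, Q x⟫_ℂ := by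
  rw [add_apply, inner_add_right, map_add]

/-- Jensen's inequality: use the tangent to `η` at `⟪e, P e⟫`, or let the point of tangency tend to
`0` when this value vanishes. -/
theorem re_inner_cfc_negMulLog_le {P : H →L[ℂ] H} (hP : 0 ≤ P) {e : H} (he : ‖e‖ = 1) :
    RCLike.re ⟪e, cfc Real.negMulLog P e⟫_ℂ ≤ Real.negMulLog (RCLike.re ⟪e, P e⟫_ℂ) := by
  have key : ∀ t : ℝ, 0 < t → RCLike.re ⟪e, cfc Real.negMulLog P e⟫_ℂ ≤
      (-Real.log t - 1) * RCLike.re ⟪e, P e⟫_ℂ + t := by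
    intro t ht
    have h1 : cfc Real.negMulLog P ≤ (-Real.log t - 1) • P + t • 1 := by
      rw [← Algebra.algebraMap_eq_smul_one, ← cfc_const_mul_id (-Real.log t - 1) P,
        ← cfc_add_const t (fun x : ℝ => (-Real.log t - 1) * x) P]
      exact cfc_mono (fun x hx => negMulLog_le_tangent ht (spectrum_nonneg_of_nonneg hP hx))
        Real.continuous_negMulLog.continuousOn (by fun_prop)
    refine (re_inner_mono h1 e).trans_eq ?_
    rw [re_inner_add_apply, re_inner_smul_apply, re_inner_smul_apply, one_apply_eq_self,
      inner_self_eq_norm_sq, he]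
    ring
  rcases (re_inner_nonneg hP e).eq_or_lt with h0 | h0
  · rw [← h0, Real.negMulLog_zero]
    refine le_of_forall_pos_le_add fun t ht => ?_
    have := key t ht
    rwa [← h0, mul_zero] at this
  · refine (key _ h0).trans_eq ?_
    rw [Real.negMulLog]
    ring

theorem negMulLog_le_re_inner_cfc {P : H →L[ℂ] H} (hP : 0 ≤ P) (hP1 : P ≤ 1) {e : H}
    (he : ‖e‖ = 1) {μ : ℝ} (hμ : P e = μ • e) :
    Real.negMulLog μ ≤ RCLike.re ⟪e, cfc Real.negMulLog P e⟫_ℂ := by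
  have hq : RCLike.re ⟪e, P e⟫_ℂ = μ := by
    rw [hμ, ← Complex.coe_smul, inner_smul_right, inner_self_eq_norm_sq_to_K, he]
    simp
  have hq2 : RCLike.re ⟪e, (P ^ 2) e⟫_ℂ = μ ^ 2 := by
    rw [pow_two, mul_apply_eq_comp, hμ, ← Complex.coe_smul, map_smul, hμ,
      ← Complex.coe_smul, smul_smul,
      inner_smul_right, inner_self_eq_norm_sq_to_K, he]
    simp [pow_two]
  have hμ0 : 0 ≤ μ := hq ▸ re_inner_nonneg hP e
  rcases hμ0.eq_or_lt with rfl | h0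
  · rw [Real.negMulLog_zero]
    refine re_inner_nonneg (cfc_nonneg fun x hx => ?_) e
    exact Real.negMulLog_nonneg (spectrum_subset_Icc hP hP1 hx).1 (spectrum_subset_Icc hP hP1 hx).2
  have h1 : (1 - Real.log μ) • P + (-μ⁻¹) • P ^ 2 ≤ cfc Real.negMulLog P := by
    have e1 : cfc (fun x : ℝ => (1 - Real.log μ) * x) P = (1 - Real.log μ) • P :=
      cfc_const_mul_id _ P hP.isSelfAdjoint
    have e2 : cfc (fun x : ℝ => -μ⁻¹ * x ^ 2) P = (-μ⁻¹) • P ^ 2 := by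
      rw [cfc_const_mul (-μ⁻¹) (fun x : ℝ => x ^ 2) P, cfc_pow_id P 2 (ha := hP.isSelfAdjoint)]
    rw [← e1, ← e2,
      ← cfc_add P (fun x : ℝ => (1 - Real.log μ) * x) (fun x : ℝ => -μ⁻¹ * x ^ 2)]
    exact cfc_mono (fun x hx => parabola_le_negMulLog h0 (spectrum_nonneg_of_nonneg hP hx))
      (by fun_prop) Real.continuous_negMulLog.continuousOn
  refine le_of_eq_of_le ?_ (re_inner_mono h1 e)
  rw [re_inner_add_apply, re_inner_smul_apply, re_inner_smul_apply, hq, hq2, Real.negMulLog]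
  field_simp
  ring

/-- In an eigenbasis of the mixture its eigenvalues are the mixed diagonal entries of `P` and `Q`,
so Jensen for each operator and scalar concavity of `η` give the bound entry by entry. -/
theorem trace_cfc_negMulLog_concave {P Q : H →L[ℂ] H} (hP : 0 ≤ P) (hP1 : P ≤ 1) (hQ : 0 ≤ Q)
    (hQ1 : Q ≤ 1) {a b : ℝ} (ha : 0 ≤ a) (hb : 0 ≤ b) (hab : a + b = 1)
    (htr : trace (a • P + b • Q) ≠ ∞) :
    ENNReal.ofReal a * trace (cfc Real.negMulLog P) +
        ENNReal.ofReal b * trace (cfc Real.negMulLog Q) ≤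
      trace (cfc Real.negMulLog (a • P + b • Q)) := by
  have hη : ∀ R : H →L[ℂ] H, 0 ≤ R → R ≤ 1 → 0 ≤ cfc Real.negMulLog R := fun R hR hR1 =>
    cfc_nonneg fun x hx =>
      Real.negMulLog_nonneg (spectrum_subset_Icc hR hR1 hx).1 (spectrum_subset_Icc hR hR1 hx).2
  have hR : 0 ≤ a • P + b • Q := add_nonneg (smul_nonneg ha hP) (smul_nonneg hb hQ)
  have hR1 : a • P + b • Q ≤ 1 := by
    refine (add_le_add (smul_le_smul_of_nonneg_left hP1 ha)
      (smul_le_smul_of_nonneg_left hQ1 hb)).trans_eq ?_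
    rw [← add_smul, hab, one_smul]
  obtain ⟨ι, v, μ, hv⟩ := exists_eigenbasis hR htr
  rw [trace_eq_tsum v (hη _ hP hP1), trace_eq_tsum v (hη _ hQ hQ1), trace_eq_tsum v (hη _ hR hR1),
    ← ENNReal.tsum_mul_left, ← ENNReal.tsum_mul_left, ← ENNReal.tsum_add]
  refine ENNReal.tsum_le_tsum fun i => ?_
  have he := v.orthonormal.norm_eq_one i
  rw [← ENNReal.ofReal_mul ha, ← ENNReal.ofReal_mul hb,
    ← ENNReal.ofReal_add (mul_nonneg ha (re_inner_nonneg (hη _ hP hP1) _))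
      (mul_nonneg hb (re_inner_nonneg (hη _ hQ hQ1) _))]
  refine ENNReal.ofReal_le_ofReal (le_trans ?_ (negMulLog_le_re_inner_cfc hR hR1 he (hv i)))
  have hq : μ i = a * RCLike.re ⟪v i, P (v i)⟫_ℂ + b * RCLike.re ⟪v i, Q (v i)⟫_ℂ := by
    rw [← re_inner_smul_apply, ← re_inner_smul_apply, ← re_inner_add_apply, hv,
      ← Complex.coe_smul, inner_smul_right, inner_self_eq_norm_sq_to_K, he]
    simp
  rw [hq]
  refine (add_le_add (mul_le_mul_of_nonneg_left (re_inner_cfc_negMulLog_le hP he) ha)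
    (mul_le_mul_of_nonneg_left (re_inner_cfc_negMulLog_le hQ he) hb)).trans ?_
  exact Real.concaveOn_negMulLog.2 (re_inner_nonneg hP _) (re_inner_nonneg hQ _) ha hb hab

/-! ### The homogeneous entropy -/

theorem trace_ne_top {ρ : TraceClass H} (hρ : 0 ≤ (ρ : H →L[ℂ] H)) :
    trace (ρ : H →L[ℂ] H) ≠ ∞ := by
  have h : traceNorm (ρ : H →L[ℂ] H) < ∞ := ρ.2
  rw [traceNorm, CFC.abs_of_nonneg _ hρ] at h
  exact h.ne

theorem entropy_eq (ρ : TraceClass H) :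
    entropy ρ = trace (ρ : H →L[ℂ] H) *
      trace (cfc Real.negMulLog ((trace (ρ : H →L[ℂ] H)).toReal⁻¹ • (ρ : H →L[ℂ] H))) := by
  rw [entropy, stateEntropy, ← Complex.ofReal_inv, Complex.coe_smul]

theorem entropy_eq_zero_of_trace_eq_zero {ρ : TraceClass H} (h : trace (ρ : H →L[ℂ] H) = 0) :
    entropy ρ = 0 := by
  rw [entropy, h, zero_mul]

theorem entropy_smul {c : ℝ} (hc : 0 < c) (ρ : TraceClass H) :
    entropy ((c : ℂ) • ρ) = ENNReal.ofReal c * entropy ρ := by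
  rw [entropy_eq, entropy_eq, Submodule.coe_smul, Complex.coe_smul, trace_smul hc.le, mul_assoc,
    ENNReal.toReal_mul, ENNReal.toReal_ofReal hc.le, smul_smul, mul_inv_rev, mul_assoc,
    inv_mul_cancel₀ hc.ne', mul_one]

theorem trace_normalize {P : H →L[ℂ] H} (h0 : trace P ≠ 0) (h : trace P ≠ ∞) :
    trace ((trace P).toReal⁻¹ • P) = 1 := by
  have ha : 0 < (trace P).toReal := ENNReal.toReal_pos h0 h
  rw [trace_smul (by positivity), ENNReal.ofReal_inv_of_pos ha, ENNReal.ofReal_toReal h,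
    ENNReal.inv_mul_cancel h0 h]

theorem normalize_nonneg {P : H →L[ℂ] H} (hP : 0 ≤ P) : 0 ≤ (trace P).toReal⁻¹ • P :=
  smul_nonneg (inv_nonneg.2 ENNReal.toReal_nonneg) hP

/-- Concavity for the normalized operators with weights proportional to their traces, multiplied by
the total trace. -/
theorem entropy_add_entropy_le {ρ σ : TraceClass H} (hρ : 0 ≤ (ρ : H →L[ℂ] H))
    (hσ : 0 ≤ (σ : H →L[ℂ] H)) : entropy ρ + entropy σ ≤ entropy (ρ + σ) := by
  by_cases hρ0 : trace (ρ : H →L[ℂ] H) = 0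
  · rw [entropy_eq_zero_of_trace_eq_zero hρ0,
      show ρ = 0 from Subtype.ext (eq_zero_of_trace_eq_zero hρ hρ0), zero_add, zero_add]
  by_cases hσ0 : trace (σ : H →L[ℂ] H) = 0
  · rw [entropy_eq_zero_of_trace_eq_zero hσ0,
      show σ = 0 from Subtype.ext (eq_zero_of_trace_eq_zero hσ hσ0), add_zero, add_zero]
  have h1 := trace_normalize hρ0 (trace_ne_top hρ)
  have h2 := trace_normalize hσ0 (trace_ne_top hσ)
  have n1 := normalize_nonneg hρ
  have n2 := normalize_nonneg hσ
  rw [entropy_eq, entropy_eq, entropy_eq, Submodule.coe_add, trace_add hρ hσ,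
    ENNReal.toReal_add (trace_ne_top hρ) (trace_ne_top hσ)]
  have ha : 0 < (trace (ρ : H →L[ℂ] H)).toReal := ENNReal.toReal_pos hρ0 (trace_ne_top hρ)
  have hb : 0 < (trace (σ : H →L[ℂ] H)).toReal := ENNReal.toReal_pos hσ0 (trace_ne_top hσ)
  have ta := ENNReal.ofReal_toReal (trace_ne_top hρ)
  have tb := ENNReal.ofReal_toReal (trace_ne_top hσ)
  set a := (trace (ρ : H →L[ℂ] H)).toReal
  set b := (trace (σ : H →L[ℂ] H)).toReal
  have hdec : (a + b)⁻¹ • ((ρ : H →L[ℂ] H) + σ) =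
      (a / (a + b)) • (a⁻¹ • (ρ : H →L[ℂ] H)) + (b / (a + b)) • (b⁻¹ • (σ : H →L[ℂ] H)) := by
    rw [smul_smul, smul_smul, smul_add]
    congr 2 <;> field_simp
  have hconc := trace_cfc_negMulLog_concave n1 (le_one_of_trace_le_one n1 h1.le) n2
    (le_one_of_trace_le_one n2 h2.le) (a := a / (a + b)) (b := b / (a + b)) (by positivity)
    (by positivity) (by field_simp) (by
      rw [trace_add (smul_nonneg (by positivity) n1) (smul_nonneg (by positivity) n2),
        trace_smul (by positivity) (a⁻¹ • (ρ : H →L[ℂ] H)),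
        trace_smul (by positivity) (b⁻¹ • (σ : H →L[ℂ] H)), h1, h2]
      simp)
  rw [← ta, ← tb, ← ENNReal.ofReal_add ha.le hb.le, hdec]
  refine le_trans (le_of_eq ?_) (mul_le_mul_right hconc _)
  rw [mul_add, ← mul_assoc, ← mul_assoc, ← ENNReal.ofReal_mul (by positivity),
    ← ENNReal.ofReal_mul (by positivity), mul_div_cancel₀ _ (by positivity),
    mul_div_cancel₀ _ (by positivity)]

/-- Functional-calculus form of `η(tx) = t η(x) + x η(t)`. -/
theorem trace_cfc_negMulLog_smul {P : H →L[ℂ] H} (hP : 0 ≤ P) (hP1 : P ≤ 1) {t : ℝ} (ht : 0 ≤ t)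
    (ht1 : t ≤ 1) : trace (cfc Real.negMulLog (t • P)) =
      ENNReal.ofReal t * trace (cfc Real.negMulLog P) +
        ENNReal.ofReal (Real.negMulLog t) * trace P := by
  have hη := Real.negMulLog_nonneg ht ht1
  have h : cfc Real.negMulLog (t • P) = t • cfc Real.negMulLog P + Real.negMulLog t • P := by
    rw [← cfc_comp_smul t Real.negMulLog P Real.continuous_negMulLog.continuousOn]
    simp only [smul_eq_mul, Real.negMulLog_mul]
    rw [cfc_add P (fun x => x * Real.negMulLog t) (fun x => t * Real.negMulLog x)
      (by fun_prop) (by fun_prop), cfc_const_mul t _ P, add_comm]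
    simp_rw [mul_comm _ (Real.negMulLog t)]
    rw [cfc_const_mul_id _ P]
  have h0 : 0 ≤ cfc Real.negMulLog P := cfc_nonneg fun x hx =>
    Real.negMulLog_nonneg (spectrum_subset_Icc hP hP1 hx).1 (spectrum_subset_Icc hP hP1 hx).2
  rw [h, trace_add (smul_nonneg ht h0) (smul_nonneg hη hP), trace_smul ht, trace_smul hη]

/-- Gibbs' inequality, the sum of the tangent bounds at `p` and `q`. -/
theorem negMulLog_add_negMulLog_le {x y p q : ℝ} (hx : 0 ≤ x) (hy : 0 ≤ y) (hxy : x + y = 1)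
    (hp : 0 < p) (hq : 0 < q) (hpq : p + q = 1) :
    Real.negMulLog x + Real.negMulLog y ≤ -x * Real.log p - y * Real.log q := by
  have h1 := negMulLog_le_tangent hp hx
  have h2 := negMulLog_le_tangent hq hy
  nlinarith

/-- The weights `p`, `q` are free rather than the optimal trace ratios. The mixing term is then
linear in the traces and increasing in each, so upper bounds on the traces suffice later. -/
theorem entropy_add_le {ρ σ : TraceClass H} (hρ : 0 ≤ (ρ : H →L[ℂ] H))
    (hσ : 0 ≤ (σ : H →L[ℂ] H)) {p q : ℝ} (hp : 0 < p) (hq : 0 < q) (hpq : p + q = 1) :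
    entropy (ρ + σ) ≤ entropy ρ + entropy σ +
      ENNReal.ofReal (-(trace (ρ : H →L[ℂ] H)).toReal * Real.log p -
        (trace (σ : H →L[ℂ] H)).toReal * Real.log q) := by
  by_cases hρ0 : trace (ρ : H →L[ℂ] H) = 0
  · rw [show ρ = 0 from Subtype.ext (eq_zero_of_trace_eq_zero hρ hρ0), zero_add]
    exact le_add_right (le_add_of_nonneg_left bot_le)
  by_cases hσ0 : trace (σ : H →L[ℂ] H) = 0
  · rw [show σ = 0 from Subtype.ext (eq_zero_of_trace_eq_zero hσ hσ0), add_zero]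
    exact le_add_right (le_add_of_nonneg_right bot_le)
  have h1 := trace_normalize hρ0 (trace_ne_top hρ)
  have h2 := trace_normalize hσ0 (trace_ne_top hσ)
  have n1 := normalize_nonneg hρ
  have n2 := normalize_nonneg hσ
  rw [entropy_eq, entropy_eq, entropy_eq, Submodule.coe_add, trace_add hρ hσ,
    ENNReal.toReal_add (trace_ne_top hρ) (trace_ne_top hσ)]
  have ha : 0 < (trace (ρ : H →L[ℂ] H)).toReal := ENNReal.toReal_pos hρ0 (trace_ne_top hρ)
  have hb : 0 < (trace (σ : H →L[ℂ] H)).toReal := ENNReal.toReal_pos hσ0 (trace_ne_top hσ)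
  have ta := ENNReal.ofReal_toReal (trace_ne_top hρ)
  have tb := ENNReal.ofReal_toReal (trace_ne_top hσ)
  set a := (trace (ρ : H →L[ℂ] H)).toReal
  set b := (trace (σ : H →L[ℂ] H)).toReal
  have hx : 0 ≤ a / (a + b) := by positivity
  have hy : 0 ≤ b / (a + b) := by positivity
  have hxy : a / (a + b) + b / (a + b) = 1 := by field_simp
  have hx1 : a / (a + b) ≤ 1 := by linarith
  have hy1 : b / (a + b) ≤ 1 := by linarith
  have hdec : (a + b)⁻¹ • ((ρ : H →L[ℂ] H) + σ) =
      (a / (a + b)) • (a⁻¹ • (ρ : H →L[ℂ] H)) + (b / (a + b)) • (b⁻¹ • (σ : H →L[ℂ] H)) := by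
    rw [smul_smul, smul_smul, smul_add]
    congr 2 <;> field_simp
  have m1 := smul_nonneg hx n1
  have m2 := smul_nonneg hy n2
  have hsub := trace_cfc_negMulLog_add_le m1 m2 (le_one_of_trace_le_one (add_nonneg m1 m2) (by
    rw [trace_add m1 m2, trace_smul hx, trace_smul hy, h1, h2, mul_one, mul_one,
      ← ENNReal.ofReal_add hx hy, hxy, ENNReal.ofReal_one]))
  rw [trace_cfc_negMulLog_smul n1 (le_one_of_trace_le_one n1 h1.le) hx hx1,
    trace_cfc_negMulLog_smul n2 (le_one_of_trace_le_one n2 h2.le) hy hy1, h1, h2, mul_one,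
    mul_one] at hsub
  rw [← ta, ← tb, ← ENNReal.ofReal_add ha.le hb.le, hdec]
  refine (mul_le_mul_right hsub _).trans ?_
  have e1 : ENNReal.ofReal (a + b) * ENNReal.ofReal (a / (a + b)) = ENNReal.ofReal a := by
    rw [← ENNReal.ofReal_mul (by positivity), mul_div_cancel₀ _ (by positivity)]
  have e2 : ENNReal.ofReal (a + b) * ENNReal.ofReal (b / (a + b)) = ENNReal.ofReal b := by
    rw [← ENNReal.ofReal_mul (by positivity), mul_div_cancel₀ _ (by positivity)]
  rw [add_add_add_comm, mul_add, mul_add, ← mul_assoc, ← mul_assoc, e1, e2,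
    ← ENNReal.ofReal_add (Real.negMulLog_nonneg hx hx1) (Real.negMulLog_nonneg hy hy1),
    ← ENNReal.ofReal_mul (by positivity)]
  gcongr
  refine (mul_le_mul_of_nonneg_left (negMulLog_add_negMulLog_le hx hy hxy hp hq hpq)
    (by positivity)).trans_eq ?_
  field_simp

variable {A B : Type*} [NormedAddCommGroup A] [InnerProductSpace ℂ A] [CompleteSpace A]
  [NormedAddCommGroup B] [InnerProductSpace ℂ B] [CompleteSpace B]

/-! ### Countable mixtures of states -/

theorem mem_states_iff {ρ : TraceClass H} :
    ρ ∈ states H ↔ 0 ≤ (ρ : H →L[ℂ] H) ∧ trace (ρ : H →L[ℂ] H) = 1 := by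
  rw [ContinuousLinearMap.nonneg_iff_isPositive]
  rfl

theorem traceNorm_of_nonneg {P : H →L[ℂ] H} (hP : 0 ≤ P) : traceNorm P = trace P := by
  rw [traceNorm, CFC.abs_of_nonneg _ hP]

/-- The state is `∑ 2^{-(n+1)} ρ n`, convergent in operator norm; its trace is found by exchanging
two sums of nonnegative terms. -/
theorem exists_mixture (ρ : ℕ → TraceClass H) (hρ : ∀ n, ρ n ∈ states H) :
    ∃ ω ∈ states H, ∀ n, (((1 / 2 : ℝ) ^ (n + 1) : ℝ) : ℂ) • (ρ n : H →L[ℂ] H) ≤ ω := by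
  have hpos : ∀ n, 0 ≤ (ρ n : H →L[ℂ] H) := fun n => (mem_states_iff.1 (hρ n)).1
  have htr : ∀ n, trace (ρ n : H →L[ℂ] H) = 1 := fun n => (mem_states_iff.1 (hρ n)).2
  have hnorm : ∀ n, ‖(ρ n : H →L[ℂ] H)‖ ≤ 1 := fun n =>
    (CStarAlgebra.norm_le_one_iff_of_nonneg _ (hpos n)).2
      (le_one_of_trace_le_one (hpos n) (htr n).le)
  set f : ℕ → (H →L[ℂ] H) := fun n => ((1 / 2 : ℝ) ^ (n + 1)) • (ρ n : H →L[ℂ] H) with hf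
  have hf0 : ∀ n, 0 ≤ f n := fun n => smul_nonneg (by positivity) (hpos n)
  have hgeo : HasSum (fun n : ℕ => (1 / 2 : ℝ) ^ (n + 1)) 1 := by
    simpa [pow_succ, div_eq_mul_inv, mul_comm] using hasSum_geometric_two' 1
  have hsum : Summable f := by
    refine Summable.of_norm_bounded hgeo.summable fun n => ?_
    rw [hf, norm_smul, Real.norm_of_nonneg (by positivity)]
    exact mul_le_of_le_one_right (by positivity) (hnorm n)
  have hle : ∀ n, f n ≤ ∑' n, f n := fun n => hsum.le_tsum n fun _ _ => hf0 _
  have hω0 : 0 ≤ ∑' n, f n := (hf0 0).trans (hle 0)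
  have hω1 : trace (∑' n, f n) = 1 := by
    have hi : ∀ x : H, ENNReal.ofReal (RCLike.re ⟪x, (∑' n, f n) x⟫_ℂ) =
        ∑' n, ENNReal.ofReal (RCLike.re ⟪x, f n x⟫_ℂ) := by
      intro x
      have h1 : HasSum (fun n => RCLike.re ⟪x, f n x⟫_ℂ) (RCLike.re ⟪x, (∑' n, f n) x⟫_ℂ) :=
        (((hsum.hasSum.mapL (ContinuousLinearMap.apply ℂ H x)).mapL (innerSL ℂ x))).mapL
          Complex.reCLM
      rw [← h1.tsum_eq, ENNReal.ofReal_tsum_of_nonneg (fun n => re_inner_nonneg (hf0 n) x)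
        h1.summable]
    simp_rw [trace, hi]
    rw [ENNReal.tsum_comm]
    calc _ = ∑' n, trace (f n) := rfl
      _ = ∑' n : ℕ, ENNReal.ofReal ((1 / 2 : ℝ) ^ (n + 1)) := by
        refine tsum_congr fun n => ?_
        rw [hf, trace_smul (by positivity), htr, mul_one]
      _ = 1 := by
        rw [← ENNReal.ofReal_tsum_of_nonneg (fun n => by positivity) hgeo.summable, hgeo.tsum_eq,
          ENNReal.ofReal_one]
  refine ⟨⟨∑' n, f n, ?_⟩, mem_states_iff.2 ⟨hω0, hω1⟩, fun n => ?_⟩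
  · change traceNorm _ < ∞
    rw [traceNorm_of_nonneg hω0, hω1]
    exact ENNReal.one_lt_top
  · rw [Complex.coe_smul]
    exact hle n

/-! ### The output entropy of a positive map -/

variable {Φ : TraceClass A →ₗ[ℂ] TraceClass B}

theorem IsPositiveMap.nonneg (hpos : IsPositiveMap Φ) {ρ : TraceClass A}
    (hρ : 0 ≤ (ρ : A →L[ℂ] A)) : 0 ≤ (Φ ρ : B →L[ℂ] B) := by
  rw [ContinuousLinearMap.nonneg_iff_isPositive] at hρ ⊢
  exact hpos ρ hρ

/-- Superadditivity for `σ = ρ + (σ - ρ)`, dropping one nonnegative term. -/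
theorem outputEntropy_mono (hpos : IsPositiveMap Φ) {ρ σ : TraceClass A}
    (hρ : 0 ≤ (ρ : A →L[ℂ] A)) (h : (ρ : A →L[ℂ] A) ≤ σ) :
    outputEntropy Φ ρ ≤ outputEntropy Φ σ := by
  have h1 : 0 ≤ ((σ - ρ : TraceClass A) : A →L[ℂ] A) := sub_nonneg.2 h
  have h2 := entropy_add_entropy_le (hpos.nonneg hρ) (hpos.nonneg h1)
  rw [← map_add, add_sub_cancel] at h2
  exact le_self_add.trans h2

theorem outputEntropy_smul {c : ℝ} (hc : 0 < c) (ρ : TraceClass A) :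
    outputEntropy Φ ((c : ℂ) • ρ) = ENNReal.ofReal c * outputEntropy Φ ρ := by
  rw [outputEntropy, map_smul, entropy_smul hc, outputEntropy]

theorem maxOutputEntropy_lt_top (hpos : IsPositiveMap Φ)
    (hfin : ∀ ρ ∈ states A, outputEntropy Φ ρ < ⊤) : maxOutputEntropy Φ < ⊤ := by
  by_contra hcon
  rw [not_lt_top_iff] at hcon
  -- The factor `2 ^ (n + 1)` cancels the weight of `ρ n` in the mixture, leaving the lower bound
  -- `n`.
  have hex : ∀ n : ℕ, ∃ ρ ∈ states A, ENNReal.ofReal (2 ^ (n + 1) * n) < outputEntropy Φ ρ := by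
    intro n
    have h : ENNReal.ofReal (2 ^ (n + 1) * n) < maxOutputEntropy Φ := by
      rw [hcon]
      exact ENNReal.ofReal_lt_top
    simpa [maxOutputEntropy, lt_iSup_iff] using h
  choose ρ hρ hlarge using hex
  obtain ⟨ω, hω, hle⟩ := exists_mixture ρ hρ
  have hn : ∀ n : ℕ, (n : ℝ≥0∞) ≤ outputEntropy Φ ω := by
    intro n
    have h0 : (0 : ℝ) < (1 / 2) ^ (n + 1) := by positivity
    have h1 : outputEntropy Φ ((((1 / 2 : ℝ) ^ (n + 1) : ℝ) : ℂ) • ρ n) ≤ outputEntropy Φ ω := by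
      refine outputEntropy_mono hpos ?_ (hle n)
      rw [Submodule.coe_smul, Complex.coe_smul]
      exact smul_nonneg h0.le (mem_states_iff.1 (hρ n)).1
    rw [outputEntropy_smul h0] at h1
    refine le_trans ?_ ((mul_le_mul_right (hlarge n).le _).trans h1)
    rw [← ENNReal.ofReal_mul h0.le, ← mul_assoc, ← mul_pow]
    norm_num
  obtain ⟨n, hlt⟩ := ENNReal.exists_nat_gt (hfin ω hω).ne
  exact (hn n).not_gt hlt

theorem exists_jordan_decomposition {ρ σ : TraceClass H} (hρ : ρ ∈ states H) (hσ : σ ∈ states H) :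
    ∃ S T : TraceClass H, 0 ≤ (S : H →L[ℂ] H) ∧ 0 ≤ (T : H →L[ℂ] H) ∧ ρ + T = σ + S ∧
      trace (S : H →L[ℂ] H) = ENNReal.ofReal (traceDist ρ σ) ∧
      trace (T : H →L[ℂ] H) = ENNReal.ofReal (traceDist ρ σ) := by
  obtain ⟨hρ0, hρ1⟩ := mem_states_iff.1 hρ
  obtain ⟨hσ0, hσ1⟩ := mem_states_iff.1 hσ
  set D : H →L[ℂ] H := ((ρ - σ : TraceClass H) : H →L[ℂ] H) with hD
  have hDs : IsSelfAdjoint D := hρ0.isSelfAdjoint.sub hσ0.isSelfAdjoint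
  have hS : 0 ≤ D⁺ := CFC.posPart_nonneg D
  have hT : 0 ≤ D⁻ := CFC.negPart_nonneg D
  have habs : traceNorm D = trace D⁺ + trace D⁻ := by
    rw [traceNorm, ← CFC.posPart_add_negPart D hDs, trace_add hS hT]
  have hfin : trace D⁺ + trace D⁻ < ∞ := habs ▸ (ρ - σ).2
  obtain ⟨hSf, hTf⟩ := ENNReal.add_lt_top.1 hfin
  have heq : (ρ : H →L[ℂ] H) + D⁻ = σ + D⁺ := by
    rw [add_comm (σ : H →L[ℂ] H), ← sub_eq_sub_iff_add_eq_add]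
    exact (CFC.posPart_sub_negPart D hDs).symm
  -- Equal traces come from the additive identity by cancelling `1`, since `trace` is meaningful on
  -- positive operators only.
  have htr : trace D⁻ = trace D⁺ := by
    have h := congrArg trace heq
    rwa [trace_add hρ0 hT, trace_add hσ0 hS, hρ1, hσ1, ENNReal.add_right_inj (by simp)] at h
  have hdist : ENNReal.ofReal (traceDist ρ σ) = trace D⁺ := by
    rw [traceDist, ← hD, habs, htr, ENNReal.toReal_add hSf.ne hSf.ne, ← two_mul, ← mul_assoc]
    norm_num [ENNReal.ofReal_toReal hSf.ne]
  refine ⟨⟨D⁺, ?_⟩, ⟨D⁻, ?_⟩, hS, hT, Subtype.ext heq, hdist.symm, htr.trans hdist.symm⟩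
  · change traceNorm _ < ∞
    rwa [traceNorm_of_nonneg hS]
  · change traceNorm _ < ∞
    rwa [traceNorm_of_nonneg hT]

theorem traceDist_nonneg (ρ σ : TraceClass H) : 0 ≤ traceDist ρ σ :=
  mul_nonneg (by norm_num) ENNReal.toReal_nonneg

theorem traceDist_comm (ρ σ : TraceClass H) : traceDist ρ σ = traceDist σ ρ := by
  rw [traceDist, traceDist, ← neg_sub σ ρ, Submodule.coe_neg, traceNorm, CFC.abs_neg, traceNorm]

theorem gFun_eq {ε : ℝ} (hε : 0 < ε) :
    gFun ε = -Real.log (1 / (1 + ε)) - ε * Real.log (ε / (1 + ε)) := by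
  have h : 1 - ε / (1 + ε) = 1 / (1 + ε) := by field_simp; ring
  rw [gFun, Real.binEntropy_eq_negMulLog_add_negMulLog_one_sub, h, Real.negMulLog, Real.negMulLog]
  field_simp
  ring

theorem outputEntropy_bounds_of_trace_eq {c : ℝ} (hc : 0 < c) {T : TraceClass A}
    (hT : 0 ≤ (T : A →L[ℂ] A)) (htr : trace (T : A →L[ℂ] A) = ENNReal.ofReal c) :
    ENNReal.ofReal c * minOutputEntropy Φ ≤ outputEntropy Φ T ∧
      outputEntropy Φ T ≤ ENNReal.ofReal c * maxOutputEntropy Φ := by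
  have hc0 : (c : ℂ) ≠ 0 := by exact_mod_cast hc.ne'
  have hτ : ((c⁻¹ : ℝ) : ℂ) • T ∈ states A := by
    rw [mem_states_iff, Submodule.coe_smul, Complex.coe_smul, trace_smul (by positivity), htr,
      ← ENNReal.ofReal_mul (by positivity), inv_mul_cancel₀ hc.ne', ENNReal.ofReal_one]
    exact ⟨smul_nonneg (by positivity) hT, rfl⟩
  have h : outputEntropy Φ T = ENNReal.ofReal c * outputEntropy Φ (((c⁻¹ : ℝ) : ℂ) • T) := by
    rw [← outputEntropy_smul hc, smul_smul, ← Complex.ofReal_mul, mul_inv_cancel₀ hc.ne',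
      Complex.ofReal_one, one_smul]
  rw [h]
  exact ⟨mul_le_mul_right (iInf₂_le _ hτ) _,
    mul_le_mul_right (le_iSup₂ (f := fun ρ (_ : ρ ∈ states A) => outputEntropy Φ ρ) _ hτ) _⟩

theorem toReal_outputEntropy_sub_le (hpos : IsPositiveMap Φ) (htr : IsTraceNonincreasing Φ)
    (hfin : ∀ ρ ∈ states A, outputEntropy Φ ρ < ⊤) {ρ σ : TraceClass A} (hρ : ρ ∈ states A)
    (hσ : σ ∈ states A) :
    (outputEntropy Φ ρ).toReal - (outputEntropy Φ σ).toReal ≤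
      traceDist ρ σ * ((maxOutputEntropy Φ).toReal - (minOutputEntropy Φ).toReal) +
        gFun (traceDist ρ σ) := by
  obtain ⟨hρ0, hρ1⟩ := mem_states_iff.1 hρ
  obtain ⟨hσ0, hσ1⟩ := mem_states_iff.1 hσ
  obtain ⟨S, T, hS, hT, heq, hSt, hTt⟩ := exists_jordan_decomposition hρ hσ
  -- At `ε = 0` the weight `ε / (1 + ε)` would not be positive, but then `ρ = σ`.
  rcases (traceDist_nonneg ρ σ).eq_or_lt with h0 | hε
  · rw [← h0, ENNReal.ofReal_zero] at hSt hTt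
    have hS0 : S = 0 := Subtype.ext (eq_zero_of_trace_eq_zero hS hSt)
    have hT0 : T = 0 := Subtype.ext (eq_zero_of_trace_eq_zero hT hTt)
    rw [hS0, hT0, add_zero, add_zero] at heq
    rw [← h0, heq]
    simp [gFun]
  set ε := traceDist ρ σ
  have hmax := maxOutputEntropy_lt_top hpos hfin
  have hmin : minOutputEntropy Φ < ⊤ := (iInf₂_le ρ hρ).trans_lt (hfin ρ hρ)
  have hp : 0 < 1 / (1 + ε) := by positivity
  have hq : 0 < ε / (1 + ε) := by positivity
  have hpq : 1 / (1 + ε) + ε / (1 + ε) = 1 := by field_simp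
  have h1 := entropy_add_entropy_le (hpos.nonneg hρ0) (hpos.nonneg hT)
  have h2 := entropy_add_le (hpos.nonneg hσ0) (hpos.nonneg hS) hp hq hpq
  rw [← map_add, heq, map_add] at h1
  -- Both logarithms are nonpositive, so the term is largest at traces `1` and `ε`, where it equals
  -- `g(ε)`.
  have hb : -(trace (Φ σ : B →L[ℂ] B)).toReal * Real.log (1 / (1 + ε)) -
      (trace (Φ S : B →L[ℂ] B)).toReal * Real.log (ε / (1 + ε)) ≤ gFun ε := by
    have t1 : (trace (Φ σ : B →L[ℂ] B)).toReal ≤ 1 := by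
      refine ENNReal.toReal_le_of_le_ofReal zero_le_one ?_
      rw [ENNReal.ofReal_one, ← hσ1]
      exact htr σ hσ.1
    have t2 : (trace (Φ S : B →L[ℂ] B)).toReal ≤ ε := by
      refine ENNReal.toReal_le_of_le_ofReal hε.le ?_
      rw [← hSt]
      exact htr S ((ContinuousLinearMap.nonneg_iff_isPositive _).1 hS)
    have l1 : Real.log (1 / (1 + ε)) ≤ 0 := Real.log_nonpos hp.le (by linarith)
    have l2 : Real.log (ε / (1 + ε)) ≤ 0 := Real.log_nonpos hq.le (by linarith)
    rw [gFun_eq hε]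
    nlinarith [mul_nonneg (sub_nonneg.2 t1) (neg_nonneg.2 l1),
      mul_nonneg (sub_nonneg.2 t2) (neg_nonneg.2 l2)]
  have hg : 0 ≤ gFun ε := by
    rw [gFun]
    exact mul_nonneg (by positivity) (Real.binEntropy_nonneg hq.le (by linarith))
  -- The `H_min` term stays on the left to avoid truncated subtraction until all terms are known
  -- finite.
  have h3 : outputEntropy Φ ρ + ENNReal.ofReal ε * minOutputEntropy Φ ≤
      outputEntropy Φ σ + ENNReal.ofReal ε * maxOutputEntropy Φ + ENNReal.ofReal (gFun ε) :=
    (add_le_add le_rfl (outputEntropy_bounds_of_trace_eq hε hT hTt).1).trans <|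
      h1.trans <| h2.trans <| add_le_add
        (add_le_add le_rfl (outputEntropy_bounds_of_trace_eq hε hS hSt).2)
        (ENNReal.ofReal_le_ofReal hb)
  have f1 := (hfin σ hσ).ne
  have f2 : ENNReal.ofReal ε * maxOutputEntropy Φ ≠ ∞ :=
    ENNReal.mul_ne_top ENNReal.ofReal_ne_top hmax.ne
  have f3 : ENNReal.ofReal ε * minOutputEntropy Φ ≠ ∞ :=
    ENNReal.mul_ne_top ENNReal.ofReal_ne_top hmin.ne
  have h4 := ENNReal.toReal_mono
    (ENNReal.add_ne_top.2 ⟨ENNReal.add_ne_top.2 ⟨f1, f2⟩, ENNReal.ofReal_ne_top⟩) h3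
  rw [ENNReal.toReal_add (hfin ρ hρ).ne f3,
    ENNReal.toReal_add (ENNReal.add_ne_top.2 ⟨f1, f2⟩) ENNReal.ofReal_ne_top,
    ENNReal.toReal_add f1 f2, ENNReal.toReal_mul, ENNReal.toReal_mul,
    ENNReal.toReal_ofReal hε.le, ENNReal.toReal_ofReal hg] at h4
  linarith

end QuantumEntropy

end

theorem proposition5
    {A B : Type*}
    [NormedAddCommGroup A] [InnerProductSpace ℂ A] [CompleteSpace A]
    [TopologicalSpace.SeparableSpace A]
    [NormedAddCommGroup B] [InnerProductSpace ℂ B] [CompleteSpace B]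
    [TopologicalSpace.SeparableSpace B]
    (Φ : QuantumEntropy.TraceClass A →ₗ[ℂ] QuantumEntropy.TraceClass B)
    (hpos : QuantumEntropy.IsPositiveMap Φ)
    (htr : QuantumEntropy.IsTraceNonincreasing Φ)
    (hfin : ∀ ρ ∈ QuantumEntropy.states A, QuantumEntropy.outputEntropy Φ ρ < ⊤) :
    QuantumEntropy.maxOutputEntropy Φ < ⊤ ∧
    ∀ ρ ∈ QuantumEntropy.states A, ∀ σ ∈ QuantumEntropy.states A,
      |(QuantumEntropy.outputEntropy Φ ρ).toReal - (QuantumEntropy.outputEntropy Φ σ).toReal| ≤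
        QuantumEntropy.traceDist ρ σ *
            ((QuantumEntropy.maxOutputEntropy Φ).toReal -
              (QuantumEntropy.minOutputEntropy Φ).toReal) +
          QuantumEntropy.gFun (QuantumEntropy.traceDist ρ σ) := by
  refine ⟨QuantumEntropy.maxOutputEntropy_lt_top hpos hfin, fun ρ hρ σ hσ => ?_⟩
  refine abs_sub_le_iff.2
    ⟨QuantumEntropy.toReal_outputEntropy_sub_le hpos htr hfin hρ hσ, ?_⟩
  rw [QuantumEntropy.traceDist_comm]
  exact QuantumEntropy.toReal_outputEntropy_sub_le hpos htr hfin hσ hρ
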